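/- All graphs are finite and simple. For a graph $G$ with vertex set $V(G)$, a module of $G$ is a set $M\subseteq V(G)$ such that every vertex $v\in V(G)\setminus M$ is adjacent to all the elements of $M$ or to none of them; the modules $\emptyset$, $V(G)$ and $\{v\}$ ($v\in V(G)$) are called trivial. A graph is prime if it has at least $4$ vertices and all its modules are trivial. The modular clique number $\omega_M(G)$ is the largest size of a module of $G$ that is a clique in $G$; the modular stability number is $\alpha_M(G)=\omega_M(\overline{G})$, where $\overline{G}$ is the complement of $G$. The prime bound $p(G)$ is the smallest integer $p\ge 0$ for which there is a prime graph $H$ with $V(H)\supseteq V(G)$, $H[V(G)]=G$ and $|V(H)\setminus V(G)|=p$. Let $\iota(G)$ denote the number of isolated vertices of $G$. Theorem. Let $k\ge 1$ be an integer and let $G$ be a graph with $\max(\alpha_M(G),\omega_M(G))=2^k$. Then $p(G)=k$ or $p(G)=k+1$. Moreover, $p(G)=k+1$ if and only if $\iota(G)=2^k$ or $\iota(\overline{G})=2^k$. -/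

import Mathlib

namespace PrimeBound

/-- A set `M` of vertices is a module of `G` if every vertex outside `M` is adjacent to all the
elements of `M` or to none of them. -/
def IsModule {V : Type*} (G : SimpleGraph V) (M : Set V) : Prop :=
  ∀ v, v ∉ M → (∀ w ∈ M, G.Adj v w) ∨ (∀ w ∈ M, ¬ G.Adj v w)

/-- A graph is prime if it has at least four vertices and all its modules are trivial, that is,
equal to `∅`, to a singleton, or to the whole vertex set. -/
def IsPrimeGraph {V : Type*} (G : SimpleGraph V) : Prop :=
  4 ≤ ENat.card V ∧
    ∀ M : Set V, IsModule G M → M = ∅ ∨ (∃ v, M = {v}) ∨ M = Set.univ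

/-- `G` has a prime `p`-extension: a prime graph `H` whose vertex set is that of `G` together with
`p` further vertices and whose subgraph induced on the vertices of `G` is `G`. -/
def HasPrimeExtension {V : Type*} (G : SimpleGraph V) (p : ℕ) : Prop :=
  ∃ H : SimpleGraph (V ⊕ Fin p), H.comap Sum.inl = G ∧ IsPrimeGraph H

/-- The prime bound `p(G)`: the smallest `p` such that `G` has a prime `p`-extension.
(The infimum of the empty set is `0`, so a positive value is always attained.) -/
noncomputable def primeBound {V : Type*} (G : SimpleGraph V) : ℕ :=
  sInf {p : ℕ | HasPrimeExtension G p}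

/-- The modular clique number `ω_M(G)`: the largest size of a module that is a clique
(for a finite graph the set below is bounded, and it contains `0`). -/
noncomputable def modularCliqueNumber {V : Type*} (G : SimpleGraph V) : ℕ :=
  sSup {m : ℕ | ∃ M : Finset V,
    IsModule G (M : Set V) ∧ G.IsClique (M : Set V) ∧ M.card = m}

/-- The modular stability number `α_M(G) = ω_M(Gᶜ)`. -/
noncomputable def modularStabilityNumber {V : Type*} (G : SimpleGraph V) : ℕ :=
  modularCliqueNumber Gᶜ

/-- The number `ι(G)` of isolated vertices of a finite graph. -/
noncomputable def isolatedCount {V : Type*} (G : SimpleGraph V) : ℕ :=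
  {v : V | G.IsIsolated v}.ncard

end PrimeBound

/-!
Two vertices are *twins* if they form a module. Being twins is an equivalence relation, and each of
its classes is a clique or a stable set; hence the larger of the modular clique and stability
numbers is the size of a largest twin class. Suppose that size is `2 ^ k`.

*Lower bounds.* In a prime extension two twins must be told apart by the new vertices, so at least
`k` new vertices are needed. With exactly `k` of them, a twin class of `2 ^ k` vertices realizes
every possible adjacency pattern, among them the empty one; if its vertices are isolated in `G`,
then one of them is isolated in the extension, which is thus not prime
(`not_hasPrimeExtension_of_isIsolated`).

*Construction of a `k`-extension* (`hasPrimeExtension_of_stable`). Passing to the complement if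
necessary, there is a stable twin class `C` of size `2 ^ k`. An extension by `k` pairwise
nonadjacent vertices amounts to a code in `Fin k → Bool` for each vertex. The minimal modules of
`G` among those with at least two elements are the pairs of twins and the twin-free minimal modules,
and the latter are pairwise disjoint and meet no pair of twins.
Codes are chosen (`exists_code`) injective on each twin
class, nonconstant on each twin-free minimal module, and, as far as this allows, different from the
constant code `e v` that tells whether `v` is adjacent to `C`. Then

* a module of the extension without new vertices is trivial, since the codes separate two elements
  of every module of `G` that has at least two of them;
* a module with a new vertex and a vertex of `G` contains all the new vertices, because all the
  codes occur in `C`; a vertex `v` outside it has the code `e v`. If some `v` is outside, such vertices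
  belong to twin classes of size `2 ^ k`, and it follows that `2 ^ k` vertices are isolated or
  `2 ^ k` vertices are universal (`exists_isolated_of_module`).

*Construction of a `(k + 1)`-extension* when `2 ^ k` vertices are isolated
(`hasPrimeExtension_succ_of_isIsolated`). Joining one new vertex to exactly these vertices gives a
graph to which the previous construction applies.
-/

namespace PrimeBound

variable {V : Type*} {G : SimpleGraph V}

/-! ### Modules -/

theorem IsModule.adj_iff {M : Set V} (hM : IsModule G M) {x u v : V} (hx : x ∉ M) (hu : u ∈ M)
    (hv : v ∈ M) : G.Adj x u ↔ G.Adj x v := by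
  rcases hM x hx with h | h
  · exact iff_of_true (h u hu) (h v hv)
  · exact iff_of_false (h u hu) (h v hv)

theorem isModule_of_adj_iff {M : Set V}
    (h : ∀ x, x ∉ M → ∀ u ∈ M, ∀ v ∈ M, G.Adj x u → G.Adj x v) : IsModule G M := by
  intro x hx
  by_cases hu : ∃ u ∈ M, G.Adj x u
  · obtain ⟨u, hu, hxu⟩ := hu
    exact .inl fun v hv => h x hx u hu v hv hxu
  · exact .inr fun v hv hxv => hu ⟨v, hv, hxv⟩

theorem isModule_inter {A B : Set V} (hA : IsModule G A) (hB : IsModule G B) :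
    IsModule G (A ∩ B) := by
  refine isModule_of_adj_iff fun x hx u hu v hv h => ?_
  by_cases hxA : x ∈ A
  · exact (hB.adj_iff (fun hxB => hx ⟨hxA, hxB⟩) hu.2 hv.2).1 h
  · exact (hA.adj_iff hxA hu.1 hv.1).1 h

theorem isModule_sdiff {A B : Set V} (hA : IsModule G A) (hB : IsModule G B) {u : V}
    (huB : u ∈ B) (huA : u ∉ A) : IsModule G (A \ B) := by
  refine isModule_of_adj_iff fun x hx y hy z hz h => ?_
  by_cases hxA : x ∈ A
  · have hxB : x ∈ B := by by_contra hxB; exact hx ⟨hxA, hxB⟩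
    -- `x` and `u` both lie in `B`, so they look alike from `y` and `z`, and `u` is outside `A`
    have h₁ : G.Adj u y := ((hB.adj_iff hy.2 hxB huB).1 h.symm).symm
    have h₂ : G.Adj u z := (hA.adj_iff huA hy.1 hz.1).1 h₁
    exact ((hB.adj_iff hz.2 huB hxB).1 h₂.symm).symm
  · exact (hA.adj_iff hxA hy.1 hz.1).1 h

theorem isModule_compl_iff {M : Set V} : IsModule Gᶜ M ↔ IsModule G M := by
  have key : ∀ {K : SimpleGraph V}, IsModule K M → IsModule Kᶜ M := by
    intro K h
    refine isModule_of_adj_iff fun x hx u hu v hv hxu => ?_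
    rw [SimpleGraph.compl_adj] at hxu ⊢
    exact ⟨fun e => hx (e ▸ hv), fun h' => hxu.2 ((h.adj_iff hx hu hv).2 h')⟩
  exact ⟨fun h => by simpa using key h, key⟩

/-! ### Twins -/

/-- Two vertices are twins if no third vertex distinguishes them, that is, if they form a module.
They may be adjacent or not, and a vertex is a twin of itself. -/
def Twin (G : SimpleGraph V) (u v : V) : Prop :=
  ∀ x, x ≠ u → x ≠ v → (G.Adj x u ↔ G.Adj x v)

theorem Twin.refl (G : SimpleGraph V) (u : V) : Twin G u u := fun _ _ _ => Iff.rfl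

theorem Twin.symm {u v : V} (h : Twin G u v) : Twin G v u := fun x hv hu => (h x hu hv).symm

theorem Twin.trans {u v w : V} (h₁ : Twin G u v) (h₂ : Twin G v w) : Twin G u w := by
  by_cases huv : u = v
  · exact huv ▸ h₂
  by_cases hvw : v = w
  · exact hvw ▸ h₁
  by_cases huw : u = w
  · exact huw ▸ Twin.refl G u
  intro x hxu hxw
  by_cases hxv : x = v
  · subst hxv
    rw [G.adj_comm x u, G.adj_comm x w, h₂ u (Ne.symm hxu) huw, G.adj_comm u w]
    exact h₁ w (Ne.symm huw) (Ne.symm hxw)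
  · exact (h₁ x hxu hxv).trans (h₂ x hxv hxw)

theorem Twin.isModule {u v : V} (h : Twin G u v) : IsModule G {u, v} := by
  refine isModule_of_adj_iff fun x hx a ha b hb hxa => ?_
  simp only [Set.mem_insert_iff, Set.mem_singleton_iff, not_or] at hx ha hb
  have := h x hx.1 hx.2
  rcases ha with rfl | rfl <;> rcases hb with rfl | rfl <;> tauto

theorem IsModule.twin {u v : V} (h : IsModule G {u, v}) : Twin G u v := fun x hu hv =>
  h.adj_iff (by simp [hu, hv]) (by simp) (by simp)

theorem twin_compl_iff {u v : V} : Twin Gᶜ u v ↔ Twin G u v :=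
  ⟨fun h => (isModule_compl_iff.1 h.isModule).twin, fun h => (isModule_compl_iff.2 h.isModule).twin⟩

/-- The equivalence relation of being twins. -/
def twinSetoid (G : SimpleGraph V) : Setoid V where
  r := Twin G
  iseqv := ⟨Twin.refl G, Twin.symm, Twin.trans⟩

/-- The set of all twins of `v`, including `v` itself. -/
def twinClass (G : SimpleGraph V) (v : V) : Set V := {u | Twin G u v}

theorem twinClass_compl (v : V) : twinClass Gᶜ v = twinClass G v :=
  Set.ext fun _ => twin_compl_iff

theorem twinClass_eq_of_twin {u v : V} (h : Twin G u v) : twinClass G u = twinClass G v :=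
  Set.ext fun _ => ⟨fun hw => hw.trans h, fun hw => hw.trans h.symm⟩

theorem isModule_twinClass (v : V) : IsModule G (twinClass G v) := by
  refine isModule_of_adj_iff fun x hx a ha b hb h => ?_
  have hab : Twin G a b := Twin.trans ha (Twin.symm hb)
  exact (hab x (fun e => hx (e ▸ ha)) (fun e => hx (e ▸ hb))).1 h

/-- A twin class is a clique or a stable set: from a vertex of it, the others look alike. -/
theorem isClique_twinClass_or (v : V) :
    G.IsClique (twinClass G v) ∨ Gᶜ.IsClique (twinClass G v) := by
  by_cases h : ∃ a ∈ twinClass G v, ∃ b ∈ twinClass G v, G.Adj a b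
  · left
    obtain ⟨a, ha, b, hb, hab⟩ := h
    have key : ∀ y ∈ twinClass G v, y ≠ a → G.Adj a y := by
      intro y hy hya
      have hby : Twin G b y := Twin.trans hb (Twin.symm hy)
      exact (hby a hab.ne hya.symm).1 hab
    intro x hx y hy hxy
    by_cases hxa : x = a
    · subst hxa
      exact key y hy hxy.symm
    by_cases hya : y = a
    · subst hya
      exact (key x hx hxa).symm
    have hax : Twin G a x := Twin.trans ha (Twin.symm hx)
    exact ((hax y hya hxy.symm).1 (key y hy hya).symm).symm
  · right
    intro x hx y hy hxy
    exact (SimpleGraph.compl_adj _ _ _).2 ⟨hxy, fun h' => h ⟨x, hx, y, hy, h'⟩⟩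

theorem twin_of_isClique {M : Set V} (hM : IsModule G M) (hc : G.IsClique M) {u v : V}
    (hu : u ∈ M) (hv : v ∈ M) : Twin G u v := by
  intro x hxu hxv
  by_cases hx : x ∈ M
  · exact iff_of_true (hc hx hu hxu) (hc hx hv hxv)
  · exact hM.adj_iff hx hu hv

theorem twinClass_eq_of_isIsolated {v : V} (hv : G.IsIsolated v) :
    twinClass G v = {u | G.IsIsolated u} := by
  ext u
  constructor
  · intro h x hux
    by_cases hxv : x = v
    · exact hv u (hxv ▸ hux.symm)
    · exact hv x ((h x hux.ne' hxv).1 hux.symm).symm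
  · intro h x _ _
    exact iff_of_false (fun hx => h x hx.symm) (fun hx => hv x hx.symm)

/-! ### Minimal modules without twins -/

/-- A minimal module among those with at least two elements, other than a pair of twins. Such a
module induces a prime graph. -/
structure IsTwinFreeMinimal (G : SimpleGraph V) (P : Set V) : Prop where
  isModule : IsModule G P
  nontrivial : P.Nontrivial
  eq_of_twin : ∀ u ∈ P, ∀ v ∈ P, Twin G u v → u = v
  eq_of_subset : ∀ Q ⊆ P, IsModule G Q → Q.Nontrivial → Q = P

theorem exists_twin_or_isTwinFreeMinimal [Finite V] {M : Set V} (hM : IsModule G M)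
    (hn : M.Nontrivial) :
    (∃ u ∈ M, ∃ v ∈ M, u ≠ v ∧ Twin G u v) ∨ ∃ P ⊆ M, IsTwinFreeMinimal G P := by
  obtain ⟨P, hPM, hP⟩ :=
    (Set.toFinite {Q : Set V | IsModule G Q ∧ Q.Nontrivial}).exists_le_minimal ⟨hM, hn⟩
  by_cases h : ∀ u ∈ P, ∀ v ∈ P, Twin G u v → u = v
  · exact .inr ⟨P, hPM, hP.prop.1, hP.prop.2, h, fun Q hQ h₁ h₂ =>
      Set.Subset.antisymm hQ (hP.le_of_le ⟨h₁, h₂⟩ hQ)⟩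
  · push Not at h
    obtain ⟨u, hu, v, hv, ht, hne⟩ := h
    exact .inl ⟨u, hPM hu, v, hPM hv, hne, ht⟩

namespace IsTwinFreeMinimal

variable {P : Set V}

theorem nontrivial_sdiff_singleton (hP : IsTwinFreeMinimal G P) (w : V) :
    (P \ {w}).Nontrivial := by
  obtain ⟨a, ha, b, hb, hab⟩ := hP.nontrivial
  have h : ¬ Twin G a b := fun h => hab (hP.eq_of_twin a ha b hb h)
  simp only [Twin, not_forall] at h
  obtain ⟨x, hxa, hxb, h⟩ := h
  -- a vertex distinguishing `a` from `b` is a third element of `P`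
  have hx : x ∈ P := by
    by_contra hx
    exact h (hP.isModule.adj_iff hx ha hb)
  by_cases hwa : a = w
  · exact ⟨b, ⟨hb, fun e => hab (hwa.trans e.symm)⟩, x, ⟨hx, fun e => hxa (e.trans hwa.symm)⟩,
      hxb.symm⟩
  by_cases hwb : b = w
  · exact ⟨a, ⟨ha, hwa⟩, x, ⟨hx, fun e => hxb (e.trans hwb.symm)⟩, hxa.symm⟩
  · exact ⟨a, ⟨ha, hwa⟩, b, ⟨hb, hwb⟩, hab⟩

theorem not_isModule_sdiff_singleton (hP : IsTwinFreeMinimal G P) {w : V} (hw : w ∈ P) :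
    ¬ IsModule G (P \ {w}) := by
  intro h
  have := hP.eq_of_subset _ Set.sdiff_subset h (hP.nontrivial_sdiff_singleton w)
  rw [← this] at hw
  exact hw.2 rfl

/-- A twin-free minimal module lies inside every nontrivial module that it meets. -/
theorem subset_of_mem (hP : IsTwinFreeMinimal G P) {Q : Set V} (hQ : IsModule G Q)
    (hn : Q.Nontrivial) {v : V} (hvP : v ∈ P) (hvQ : v ∈ Q) : P ⊆ Q := by
  by_contra hPQ
  have hsub : ∀ x ∈ P, x ∈ Q → x = v := by
    intro x hxP hxQ
    by_contra hxv
    have := hP.eq_of_subset _ Set.inter_subset_left (isModule_inter hP.isModule hQ)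
      ⟨x, ⟨hxP, hxQ⟩, v, ⟨hvP, hvQ⟩, hxv⟩
    exact hPQ (this ▸ Set.inter_subset_right)
  obtain ⟨u, huQ, huv⟩ := hn.exists_ne v
  have heq : P \ Q = P \ {v} := by
    ext x
    exact and_congr_right fun hx => not_congr ⟨fun h => hsub x hx h, fun h => h ▸ hvQ⟩
  exact hP.not_isModule_sdiff_singleton hvP
    (heq ▸ isModule_sdiff hP.isModule hQ huQ fun h => huv (hsub u h huQ))

theorem eq_of_twin_of_mem (hP : IsTwinFreeMinimal G P) {u v : V} (hv : v ∈ P)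
    (h : Twin G u v) : u = v := by
  by_contra huv
  have hsub := hP.subset_of_mem h.isModule (Set.nontrivial_pair huv) hv (by simp)
  obtain ⟨w, hw, hwv⟩ := hP.nontrivial.exists_ne v
  have hwu : w = u := (hsub hw).resolve_right hwv
  exact huv (hP.eq_of_twin u (hwu ▸ hw) v hv h)

theorem eq_of_mem (hP : IsTwinFreeMinimal G P) {Q : Set V} (hQ : IsTwinFreeMinimal G Q) {v : V}
    (hvP : v ∈ P) (hvQ : v ∈ Q) : P = Q :=
  Set.Subset.antisymm (hP.subset_of_mem hQ.isModule hQ.nontrivial hvP hvQ)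
    (hQ.subset_of_mem hP.isModule hP.nontrivial hvQ hvP)

theorem twinClass_eq (hP : IsTwinFreeMinimal G P) {v : V} (hv : v ∈ P) :
    twinClass G v = {v} :=
  Set.ext fun _ => ⟨fun h => hP.eq_of_twin_of_mem hv h, fun h => h ▸ Twin.refl G v⟩

end IsTwinFreeMinimal

/-! ### Assigning codes to the vertices -/

/-- A single twin class of at most `2 ^ k` vertices has injective codes in `Fin k → Bool`, which can
avoid a given code unless the class has exactly `2 ^ k` vertices. -/
theorem exists_injOn_code [Finite V] {k : ℕ} {S : Set V} (hS : S.ncard ≤ 2 ^ k)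
    (e : Fin k → Bool) :
    ∃ g : V → Fin k → Bool, S.InjOn g ∧ (S.ncard ≠ 2 ^ k → ∀ u ∈ S, g u ≠ e) := by
  classical
  have huniv : (Set.univ : Set (Fin k → Bool)).ncard = 2 ^ k := by
    rw [Set.ncard_univ, Nat.card_eq_fintype_card]; simp
  by_cases h : S.ncard = 2 ^ k
  · obtain ⟨g, -, hg⟩ := S.toFinite.exists_injOn_of_encard_le
      (t := (Set.univ : Set (Fin k → Bool))) (by
        rw [← S.toFinite.cast_ncard_eq, ← Set.finite_univ.cast_ncard_eq, huniv, h])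
    exact ⟨g, hg, fun h' => absurd h h'⟩
  · obtain ⟨g, hge, hg⟩ := S.toFinite.exists_injOn_of_encard_le
      (t := (Set.univ \ {e} : Set (Fin k → Bool))) (by
        rw [← S.toFinite.cast_ncard_eq, ← (Set.toFinite _).cast_ncard_eq,
          Set.ncard_sdiff_singleton_of_mem (Set.mem_univ e), huniv]
        exact_mod_cast Nat.le_sub_one_of_lt (lt_of_le_of_ne hS h))
    exact ⟨g, hg, fun _ u hu => (hge hu).2⟩

/-- There are codes that distinguish two elements of each module with at least two elements, and that
take the prescribed value `e` only on twin classes of `2 ^ k` elements and on one representative of each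
twin-free minimal module. -/
theorem exists_code [Finite V] {k : ℕ} (hk : 1 ≤ k) (hle : ∀ v, (twinClass G v).ncard ≤ 2 ^ k)
    (e : V → Fin k → Bool) (he : ∀ u v, Twin G u v → e u = e v)
    (heP : ∀ P, IsTwinFreeMinimal G P → ∀ u ∈ P, ∀ v ∈ P, e u = e v) :
    ∃ code : V → Fin k → Bool,
      (∀ u v, Twin G u v → code u = code v → u = v) ∧
      (∀ M, IsModule G M → M.Nontrivial → ∃ a ∈ M, ∃ b ∈ M, code a ≠ code b) ∧
      ∀ v, code v = e v → (twinClass G v).ncard = 2 ^ k ∨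
        ∃ P, IsTwinFreeMinimal G P ∧ v ∈ P ∧ ∀ y ∈ P, y ≠ v → code y ≠ e y := by
  classical
  choose g hginj hge using fun v => exists_injOn_code (hle v) (e v)
  -- one choice function per twin class
  let r : V → V := fun v => (Quotient.mk (twinSetoid G) v).out
  have hr : ∀ v, Twin G (r v) v := fun v => Quotient.mk_out (s := twinSetoid G) v
  have hr' : ∀ u v, Twin G u v → r u = r v := fun u v h =>
    congrArg Quotient.out (Quotient.sound (s := twinSetoid G) h)
  let c : V → Fin k → Bool := fun v => g (r v) v
  have hc : ∀ u v, Twin G u v → c u = c v → u = v := by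
    intro u v h huv
    refine hginj (r v) (h.trans (hr v).symm) (hr v).symm ?_
    simpa only [c, hr' u v h] using huv
  have hce : ∀ v, (twinClass G v).ncard ≠ 2 ^ k → c v ≠ e v := by
    intro v h
    rw [← twinClass_eq_of_twin (hr v)] at h
    rw [← he _ _ (hr v)]
    exact hge (r v) h v (hr v).symm
  have hcP : ∀ P, IsTwinFreeMinimal G P → ∀ v ∈ P, c v ≠ e v := by
    intro P hP v hv
    apply hce
    rw [hP.twinClass_eq hv, Set.ncard_singleton]
    exact (Nat.one_lt_two_pow (by omega)).ne
  choose rep hrep using fun P : {P // IsTwinFreeMinimal G P} => P.2.nontrivial.nonempty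
  have hrep_eq : ∀ P (hP : IsTwinFreeMinimal G P) (v), v ∈ P → v ∈ Set.range rep →
      v = rep ⟨P, hP⟩ := by
    rintro P hP v hv ⟨⟨Q, hQ⟩, rfl⟩
    obtain rfl := hP.eq_of_mem hQ hv (hrep ⟨Q, hQ⟩)
    rfl
  have hrep_twin : ∀ u v, Twin G u v → v ∈ Set.range rep → u = v := by
    rintro u v h ⟨⟨Q, hQ⟩, rfl⟩
    exact hQ.eq_of_twin_of_mem (hrep ⟨Q, hQ⟩) h
  let code : V → Fin k → Bool := fun v => if v ∈ Set.range rep then e v else c v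
  have hcode : ∀ v, v ∉ Set.range rep → code v = c v := fun v hv => if_neg hv
  have hinj : ∀ u v, Twin G u v → code u = code v → u = v := by
    intro u v h huv
    by_cases hv : v ∈ Set.range rep
    · exact hrep_twin u v h hv
    by_cases hu : u ∈ Set.range rep
    · exact (hrep_twin v u h.symm hu).symm
    · exact hc u v h (by rwa [hcode u hu, hcode v hv] at huv)
  have hP_ne : ∀ P (hP : IsTwinFreeMinimal G P) (y), y ∈ P → y ≠ rep ⟨P, hP⟩ →
      code y ≠ e y := by
    intro P hP y hy hne
    rw [hcode y fun h => hne (hrep_eq P hP y hy h)]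
    exact hcP P hP y hy
  refine ⟨code, hinj, fun M hM hn => ?_, fun v hv => ?_⟩
  · rcases exists_twin_or_isTwinFreeMinimal hM hn with ⟨u, hu, v, hv, hne, ht⟩ | ⟨P, hPM, hP⟩
    · exact ⟨u, hu, v, hv, fun h => hne (hinj u v ht h)⟩
    · obtain ⟨y, hy, hne⟩ := hP.nontrivial.exists_ne (rep ⟨P, hP⟩)
      refine ⟨y, hPM hy, _, hPM (hrep ⟨P, hP⟩), ?_⟩
      have h : code (rep ⟨P, hP⟩) = e (rep ⟨P, hP⟩) := if_pos (Set.mem_range_self _)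
      rw [h, heP P hP _ (hrep ⟨P, hP⟩) y hy]
      exact hP_ne P hP y hy hne
  · by_cases hvr : v ∈ Set.range rep
    · obtain ⟨⟨P, hP⟩, rfl⟩ := hvr
      exact .inr ⟨P, hP, hrep ⟨P, hP⟩, hP_ne P hP⟩
    · left
      by_contra h
      exact hce v h (hcode v hvr ▸ hv)

/-! ### The extension of a graph given by codes -/

/-- The extension of `G` by `k` pairwise nonadjacent vertices in which the new vertex `i` is
adjacent to the vertices `v` of `G` with `code v i = true`. -/
def extendByCode {k : ℕ} (G : SimpleGraph V) (code : V → Fin k → Bool) :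
    SimpleGraph (V ⊕ Fin k) where
  Adj
    | .inl u, .inl v => G.Adj u v
    | .inl u, .inr i => code u i = true
    | .inr i, .inl u => code u i = true
    | .inr _, .inr _ => False
  symm := ⟨by rintro (u | i) (v | j) h <;> first | exact h | exact SimpleGraph.Adj.symm (G := G) h⟩
  loopless := ⟨by rintro (u | i) h; exacts [G.loopless.irrefl u h, h]⟩

section

variable {k : ℕ} {code : V → Fin k → Bool}

@[simp] theorem extendByCode_adj_inl_inl {u v : V} :
    (extendByCode G code).Adj (.inl u) (.inl v) ↔ G.Adj u v := Iff.rfl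

@[simp] theorem extendByCode_adj_inl_inr {u : V} {i : Fin k} :
    (extendByCode G code).Adj (.inl u) (.inr i) ↔ code u i = true := Iff.rfl

@[simp] theorem extendByCode_adj_inr_inl {u : V} {i : Fin k} :
    (extendByCode G code).Adj (.inr i) (.inl u) ↔ code u i = true := Iff.rfl

end

theorem IsModule.preimage_inl {W : Type*} {H : SimpleGraph (V ⊕ W)} {M : Set (V ⊕ W)}
    (hM : IsModule H M) : IsModule (H.comap Sum.inl) (Sum.inl ⁻¹' M) :=
  isModule_of_adj_iff fun _ hx _ hu _ hv h => (hM.adj_iff hx hu hv).1 h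

/-- If a proper module `M` of the extension misses only vertices having a twin in `M`, whose twin
class is full, then `2 ^ k` vertices are isolated, or `2 ^ k` vertices are universal. The reason:
two missed vertices, one joined to all of `M` and the other to none of it, would be both adjacent
and nonadjacent. So the missed vertices are of one kind, and then their neighbours, or their
non-neighbours, can be found neither in `M` nor outside. -/
theorem exists_isolated_of_module {M : Set V} (hM : IsModule G M) {n : ℕ} {w : V} (hw : w ∉ M)
    (htwin : ∀ u, u ∉ M → (twinClass G u).ncard = n ∧ ∃ u' ∈ M, Twin G u' u) :
    ∃ v, (twinClass G v).ncard = n ∧ (G.IsIsolated v ∨ Gᶜ.IsIsolated v) := by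
  have hne : ∀ {u u'}, u ∉ M → u' ∈ M → u ≠ u' := fun hu hu' h => hu (h ▸ hu')
  refine ⟨w, (htwin w hw).1, ?_⟩
  obtain ⟨w', hw', htw⟩ := (htwin w hw).2
  -- all missed vertices are of the same kind as `w`: joined to all of `M` or to none of it
  have hmix : ∀ u, u ∉ M → (G.Adj w w' ↔ G.Adj u w') := by
    intro u hu
    by_cases huw : u = w
    · rw [huw]
    obtain ⟨u', hu', htu⟩ := (htwin u hu).2
    calc G.Adj w w' ↔ G.Adj w u' := hM.adj_iff hw hw' hu'
      _ ↔ G.Adj w u := htu w (hne hw hu') (Ne.symm huw)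
      _ ↔ G.Adj u w := G.adj_comm _ _
      _ ↔ G.Adj u w' := (htw u (hne hu hw') huw).symm
  have key : ∀ x, x ≠ w → (G.Adj w x ↔ G.Adj w w') := by
    intro x hx
    by_cases hxM : x ∈ M
    · exact hM.adj_iff hw hxM hw'
    · rw [hmix x hxM, G.adj_comm w x]
      exact (htw x (hne hxM hw') hx).symm
  by_cases h : G.Adj w w'
  · exact .inr fun x hx => by
      rw [SimpleGraph.compl_adj] at hx
      exact hx.2 ((key x hx.1.symm).2 h)
  · exact .inl fun x hx => h ((key x hx.ne').1 hx)

/-- The set of codes of a full twin class is all of `Fin k → Bool`. -/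
theorem exists_code_eq [Finite V] {k : ℕ} {code : V → Fin k → Bool} {S : Set V}
    (hS : S.ncard = 2 ^ k) (hinj : S.InjOn code) (d : Fin k → Bool) : ∃ v ∈ S, code v = d := by
  have h : code '' S = Set.univ := by
    apply Set.eq_of_subset_of_ncard_le (Set.subset_univ _)
    rw [hinj.ncard_image, hS, Set.ncard_univ, Nat.card_eq_fintype_card]
    simp
  exact h.symm.subset (Set.mem_univ d)

/-- A graph with a stable twin class of the largest possible size `2 ^ k`, in which neither `2 ^ k`
vertices are isolated nor `2 ^ k` vertices are universal, has a prime `k`-extension. -/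
theorem hasPrimeExtension_of_stable [Finite V] {k : ℕ} (hk : 1 ≤ k)
    (hle : ∀ v, (twinClass G v).ncard ≤ 2 ^ k) (c : V) (hc : (twinClass G c).ncard = 2 ^ k)
    (hst : Gᶜ.IsClique (twinClass G c))
    (hiso : ∀ v, (twinClass G v).ncard = 2 ^ k → ¬ G.IsIsolated v ∧ ¬ Gᶜ.IsIsolated v) :
    HasPrimeExtension G k := by
  classical
  have hnadj : ∀ u ∈ twinClass G c, ∀ v ∈ twinClass G c, ¬ G.Adj u v := fun u hu v hv h =>
    ((SimpleGraph.compl_adj _ _ _).1 (hst hu hv h.ne)).2 h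
  have hcc : c ∈ twinClass G c := Twin.refl G c
  have hmodC : IsModule G (twinClass G c) := isModule_twinClass c
  -- the code that `v` must not have for the new vertices to be told apart from the class of `c`
  let e : V → Fin k → Bool := fun v _ => decide (G.Adj v c)
  have he : ∀ u v, Twin G u v → e u = e v := by
    intro u v h
    have : G.Adj u c ↔ G.Adj v c := by
      by_cases hu : u ∈ twinClass G c
      · have hv : v ∈ twinClass G c := h.symm.trans hu
        exact iff_of_false (hnadj u hu c hcc) (hnadj v hv c hcc)
      · rw [G.adj_comm u, G.adj_comm v]
        refine h c (fun hcu => hu (hcu ▸ hcc)) fun hcv => hu ?_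
        rwa [hcv]
    simp only [e, this]
  have htwo : 1 < 2 ^ k := Nat.one_lt_two_pow (by omega)
  have heP : ∀ P, IsTwinFreeMinimal G P → ∀ u ∈ P, ∀ v ∈ P, e u = e v := by
    intro P hP u hu v hv
    have hcP : c ∉ P := by
      intro h
      rw [hP.twinClass_eq h, Set.ncard_singleton] at hc
      omega
    have := hP.isModule.adj_iff hcP hu hv
    rw [G.adj_comm c, G.adj_comm c] at this
    simp only [e, this]
  obtain ⟨code, hinj, hsep, hexc⟩ := exists_code hk hle e he heP
  have hsurj : ∀ d, ∃ v ∈ twinClass G c, code v = d :=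
    exists_code_eq hc fun u hu v hv => hinj u v (Twin.trans hu (Twin.symm hv))
  refine ⟨extendByCode G code, rfl, ?_, fun M hM => ?_⟩
  · -- only for `k = 1` and two vertices could the extension be too small
    have hV : 2 ^ k ≤ Nat.card V := by
      rw [← hc, ← Set.ncard_univ]
      exact Set.ncard_le_ncard (Set.subset_univ _)
    have h3 : k = 1 → Nat.card V ≠ 2 := by
      rintro rfl h2
      refine (hiso c hc).1 fun x => hnadj c hcc x ?_
      have : twinClass G c = Set.univ := by
        apply Set.eq_of_subset_of_ncard_le (Set.subset_univ _)
        rw [hc, Set.ncard_univ, h2, pow_one]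
      rw [this]
      trivial
    have h4 : 4 ≤ Nat.card (V ⊕ Fin k) := by
      rw [Nat.card_sum, Nat.card_fin]
      rcases Nat.lt_or_ge k 2 with h | h
      · obtain rfl : k = 1 := by omega
        have := h3 rfl
        rw [pow_one] at hV
        omega
      · have := Nat.pow_le_pow_right (n := 2) (by norm_num) h
        omega
    rw [ENat.card_eq_coe_natCard]
    exact_mod_cast h4
  by_cases hF : ∃ i, Sum.inr i ∈ M
  · obtain ⟨i, hi⟩ := hF
    by_cases hV : ∃ v, Sum.inl v ∈ M
    · right; right
      -- `M` meets the class of `c`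
      have hCM : ∃ a ∈ twinClass G c, Sum.inl a ∈ M := by
        by_contra! hCM
        obtain ⟨v, hv⟩ := hV
        have hvC : v ∉ twinClass G c := fun h => hCM v h hv
        obtain ⟨a, ha, hac⟩ := hsurj fun _ => true
        obtain ⟨b, hb, hbc⟩ := hsurj fun _ => false
        have h₁ := hM.adj_iff (hCM a ha) hv hi
        have h₂ := hM.adj_iff (hCM b hb) hv hi
        have h₃ := hmodC.adj_iff hvC ha hb
        simp only [extendByCode_adj_inl_inl, extendByCode_adj_inl_inr, hac, hbc,
          G.adj_comm a, G.adj_comm b] at h₁ h₂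
        simp [h₃, h₂] at h₁
      obtain ⟨a, ha, haM⟩ := hCM
      have hpos : ∀ j, Sum.inr j ∈ M → ∀ b ∈ twinClass G c, code b j = true →
          Sum.inl b ∈ M := by
        intro j hj b hb hbj
        by_contra hbM
        have := hM.adj_iff hbM haM hj
        rw [extendByCode_adj_inl_inl, extendByCode_adj_inl_inr] at this
        exact hnadj b hb a ha (this.2 hbj)
      -- the vertices of the class adjacent to `i` already realize both values of every other bit
      have hFM : ∀ j, Sum.inr j ∈ M := by
        intro j
        by_contra hj
        have hji : j ≠ i := fun h => hj (h ▸ hi)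
        obtain ⟨b, hb, hbc⟩ := hsurj fun _ => true
        obtain ⟨d, hd, hdc⟩ := hsurj fun l => decide (l = i)
        have := hM.adj_iff hj (hpos i hi b hb (by rw [hbc])) (hpos i hi d hd (by simp [hdc]))
        simp [hbc, hdc, hji] at this
      obtain ⟨t, ht, htc⟩ := hsurj fun _ => true
      have htM : Sum.inl t ∈ M := hpos i hi t ht (by rw [htc])
      have hcode : ∀ w, Sum.inl w ∉ M → code w = e w := by
        intro w hw
        funext j
        by_cases hwC : w ∈ twinClass G c
        · have h₁ : ¬ code w j = true := fun h => hw (hpos j (hFM j) w hwC h)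
          simpa [e, hnadj w hwC c hcc] using h₁
        · have h₁ := hM.adj_iff hw (hFM j) htM
          rw [extendByCode_adj_inl_inl, extendByCode_adj_inl_inr,
            hmodC.adj_iff hwC ht hcc] at h₁
          simp only [e]
          rw [Bool.eq_iff_iff, h₁, decide_eq_true_iff]
      have hVM : ∀ w, Sum.inl w ∈ M := by
        by_contra! hw
        obtain ⟨w, hw⟩ := hw
        have hmod : IsModule G (Sum.inl ⁻¹' M) := hM.preimage_inl
        obtain ⟨v, hv, hv'⟩ := exists_isolated_of_module hmod (n := 2 ^ k) hw fun u hu => by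
          rcases hexc u (hcode u hu) with h | ⟨P, hP, huP, hPe⟩
          · refine ⟨h, ?_⟩
            obtain ⟨u', hu', hne⟩ :=
              (Set.one_lt_ncard_iff_nontrivial.1 (h ▸ htwo)).exists_ne u
            refine ⟨u', ?_, hu'⟩
            by_contra hu'M
            exact hne (hinj u' u hu' (by rw [hcode u' hu'M, hcode u hu, he u' u hu']))
          · -- otherwise the rest of `P` lies in `M`, so that `u` cannot split it
            exfalso
            refine hP.not_isModule_sdiff_singleton huP
              (isModule_of_adj_iff fun x hx y hy z hz h => ?_)
            by_cases hxP : x ∈ P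
            · obtain rfl : x = u := by by_contra hxu; exact hx ⟨hxP, hxu⟩
              have hPM : ∀ y ∈ P \ {x}, y ∈ Sum.inl ⁻¹' M := fun y hy => by
                by_contra hyM
                exact hPe y hy.1 hy.2 (hcode y hyM)
              exact (hmod.adj_iff hu (hPM y hy) (hPM z hz)).1 h
            · exact (hP.isModule.adj_iff hxP hy.1 hz.1).1 h
        rcases hv' with h | h
        · exact (hiso v hv).1 h
        · exact (hiso v hv).2 h
      exact Set.eq_univ_of_forall (by rintro (v | j); exacts [hVM v, hFM j])
    · -- a module of new vertices is a singleton, as the codes tell new vertices apart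
      right; left
      refine ⟨.inr i, Set.Subset.antisymm ?_ (by simpa using hi)⟩
      rintro (v | j) hj
      · exact absurd ⟨v, hj⟩ hV
      · obtain ⟨d, hd, hdc⟩ := hsurj fun l => decide (l = i)
        have := hM.adj_iff (fun h => hV ⟨d, h⟩) hi hj
        simpa [hdc] using this
  · push Not at hF
    have hsub : ∀ x ∈ M, ∃ v, x = Sum.inl v := by
      rintro (v | i) hx
      · exact ⟨v, rfl⟩
      · exact absurd hx (hF i)
    rcases M.eq_empty_or_nonempty with h | ⟨x, hx⟩
    · exact .inl h
    obtain ⟨v, rfl⟩ := hsub x hx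
    right; left
    refine ⟨.inl v, Set.Subset.antisymm (fun y hy => ?_) (by simpa using hx)⟩
    obtain ⟨u, rfl⟩ := hsub y hy
    by_contra hne
    have hmod : IsModule G (Sum.inl ⁻¹' M) := hM.preimage_inl
    obtain ⟨a, ha, b, hb, hab⟩ := hsep _ hmod ⟨u, hy, v, hx, fun h => hne (by simp [h])⟩
    refine hab (funext fun i => ?_)
    have := hM.adj_iff (hF i) ha hb
    rwa [extendByCode_adj_inr_inl, extendByCode_adj_inr_inl, ← Bool.eq_iff_iff] at this

/-! ### Transporting prime extensions -/

theorem IsPrimeGraph.compl (h : IsPrimeGraph G) : IsPrimeGraph Gᶜ :=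
  ⟨h.1, fun M hM => h.2 M (isModule_compl_iff.1 hM)⟩

theorem HasPrimeExtension.compl {p : ℕ} (h : HasPrimeExtension G p) : HasPrimeExtension Gᶜ p := by
  obtain ⟨H, rfl, hH⟩ := h
  refine ⟨Hᶜ, ?_, hH.compl⟩
  ext u v
  simp [SimpleGraph.compl_adj]

theorem IsPrimeGraph.comap_equiv {W : Type*} (e : W ≃ V) (h : IsPrimeGraph G) :
    IsPrimeGraph (G.comap e) := by
  refine ⟨by rw [ENat.card_congr e]; exact h.1, fun M hM => ?_⟩
  have hmod : IsModule G (e '' M) := by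
    refine isModule_of_adj_iff ?_
    rintro x hx _ ⟨u, hu, rfl⟩ _ ⟨v, hv, rfl⟩ hxu
    have hx' : e.symm x ∉ M := fun h => hx ⟨_, h, e.apply_symm_apply x⟩
    have := hM.adj_iff hx' hu hv
    simp only [SimpleGraph.comap_adj, Equiv.apply_symm_apply] at this
    exact this.1 hxu
  rcases h.2 _ hmod with h | ⟨v, h⟩ | h
  · exact .inl (Set.image_eq_empty.1 h)
  · refine .inr (.inl ⟨e.symm v, ?_⟩)
    rw [← e.injective.image_injective.eq_iff, h, Set.image_singleton, e.apply_symm_apply]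
  · refine .inr (.inr ?_)
    rw [← e.injective.image_injective.eq_iff, h, Set.image_univ, e.range_eq_univ]

/-- A prime extension of a one-vertex extension `K` of `G` is a prime extension of `G`. -/
theorem HasPrimeExtension.of_sum_unit {p : ℕ} {K : SimpleGraph (V ⊕ Unit)}
    (h : HasPrimeExtension K p) : HasPrimeExtension (K.comap Sum.inl) (p + 1) := by
  obtain ⟨H, rfl, hH⟩ := h
  let e : V ⊕ Fin (p + 1) ≃ (V ⊕ Unit) ⊕ Fin p :=
    ((Equiv.refl V).sumCongr ((finSumFinEquiv.symm.trans (Equiv.sumComm _ _)).trans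
      (finOneEquiv.sumCongr (Equiv.refl _)))).trans (Equiv.sumAssoc V Unit (Fin p)).symm
  exact ⟨H.comap e, rfl, hH.comap_equiv e⟩

/-! ### Lower bounds -/

/-- The new vertices of a prime extension tell twins apart. -/
theorem injOn_adj_of_isPrimeGraph {p : ℕ} {H : SimpleGraph (V ⊕ Fin p)} (hH : IsPrimeGraph H)
    (c : V) :
    (twinClass (H.comap Sum.inl) c).InjOn
      (fun v => {i : Fin p | H.Adj (Sum.inl v) (Sum.inr i)}) := by
  intro u hu v hv huv
  by_contra hne
  have ht : Twin (H.comap Sum.inl) u v := Twin.trans hu (Twin.symm hv)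
  have hT : Twin H (.inl u) (.inl v) := by
    rintro (x | i) hxu hxv
    · exact ht x (fun h => hxu (by rw [h])) fun h => hxv (by rw [h])
    · rw [H.adj_comm, H.adj_comm _ (.inl v)]
      exact (Set.ext_iff.1 huv i :)
  have hcard : ENat.card (V ⊕ Fin p) ≠ 2 := fun h => by
    have h4 := hH.1
    rw [h] at h4
    exact absurd h4 (by norm_num)
  rcases hH.2 _ hT.isModule with h | ⟨w, h⟩ | h
  · exact (Set.insert_nonempty _ _).ne_empty h
  · have h₁ : Sum.inl u = w := h.subset (by simp)
    have h₂ : Sum.inl v = w := h.subset (by simp)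
    exact hne (Sum.inl_injective (h₁.trans h₂.symm))
  · apply hcard
    rw [← Set.encard_univ, ← h, Set.encard_pair fun h => hne (Sum.inl_injective h)]

theorem ncard_set_fin (p : ℕ) : (Set.univ : Set (Set (Fin p))).ncard = 2 ^ p := by
  rw [Set.ncard_univ, Nat.card_eq_fintype_card]
  simp

theorem le_of_hasPrimeExtension {p k : ℕ} (h : HasPrimeExtension G p) {c : V}
    (hc : (twinClass G c).ncard = 2 ^ k) : k ≤ p := by
  obtain ⟨H, rfl, hH⟩ := h
  have := Set.ncard_le_ncard (Set.subset_univ ((fun v => {i : Fin p | H.Adj (.inl v) (.inr i)}) ''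
    twinClass (H.comap Sum.inl) c))
  rw [(injOn_adj_of_isPrimeGraph hH c).ncard_image, hc, ncard_set_fin] at this
  exact (Nat.pow_le_pow_iff_right (by norm_num)).1 this

/-- If `2 ^ p` vertices are isolated, then one of them stays isolated in any `p`-extension in which
they are told apart. -/
theorem not_hasPrimeExtension_of_isIsolated {p : ℕ} {c : V} (hiso : G.IsIsolated c)
    (hc : (twinClass G c).ncard = 2 ^ p) : ¬ HasPrimeExtension G p := by
  rintro ⟨H, rfl, hH⟩
  have hinj := injOn_adj_of_isPrimeGraph hH c
  -- all sets of new vertices occur as neighbourhoods, in particular the empty one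
  have himg := Set.eq_of_subset_of_ncard_le (Set.subset_univ _)
    ((ncard_set_fin p).trans (hc.symm.trans hinj.ncard_image.symm)).le
  obtain ⟨v, hv, hv'⟩ := himg.symm.subset (Set.mem_univ ∅)
  rw [twinClass_eq_of_isIsolated hiso] at hv
  have hvH : ∀ x, ¬ H.Adj (.inl v) x := by
    rintro (x | i) h
    · exact hv x h
    · exact (hv'.subset h :)
  have hmod : IsModule H {Sum.inl v}ᶜ := by
    intro x hx
    obtain rfl : x = Sum.inl v := by simpa using hx
    exact .inr fun w _ => hvH w
  have h4 := hH.1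
  rw [← Set.encard_univ, ← Set.encard_sdiff_add_encard_of_subset
    (Set.subset_univ {Sum.inl v}), Set.encard_singleton, ← Set.compl_eq_univ_sdiff] at h4
  rcases hH.2 _ hmod with h | ⟨w, h⟩ | h
  · rw [h, Set.encard_empty] at h4
    exact absurd h4 (by norm_num)
  · rw [h, Set.encard_singleton] at h4
    exact absurd h4 (by norm_num)
  · exact absurd (h.symm.subset (Set.mem_univ (Sum.inl v))) (by simp)

/-! ### Isolated vertices -/

/-- The extension of `G` by one vertex that is adjacent exactly to the isolated vertices of `G`. -/
def joinIsolated (G : SimpleGraph V) : SimpleGraph (V ⊕ Unit) where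
  Adj
    | .inl u, .inl v => G.Adj u v
    | .inl u, .inr _ => G.IsIsolated u
    | .inr _, .inl u => G.IsIsolated u
    | .inr _, .inr _ => False
  symm := ⟨by rintro (u | i) (v | j) h <;> first | exact h | exact SimpleGraph.Adj.symm (G := G) h⟩
  loopless := ⟨by rintro (u | i) h; exacts [G.loopless.irrefl u h, h]⟩

theorem twin_of_twin_joinIsolated {u v : V} (h : Twin (joinIsolated G) (.inl u) (.inl v)) :
    Twin G u v := fun x hu hv =>
  h (.inl x) (fun e => hu (Sum.inl_injective e)) fun e => hv (Sum.inl_injective e)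

theorem not_twin_joinIsolated {c d : V} (hc : G.IsIsolated c) (hd : G.IsIsolated d) (hcd : c ≠ d)
    (v : V) : ¬ Twin (joinIsolated G) (.inl v) (.inr ()) := by
  intro h
  have key : ∀ x, x ≠ v → G.IsIsolated x → False := fun x hxv hx =>
    hx v ((h (.inl x) (fun e => hxv (Sum.inl_injective e)) (by simp)).2 hx)
  by_cases hcv : c = v
  · exact key d (fun e => hcd (hcv.trans e.symm)) hd
  · exact key c hcv hc

/-- If `2 ^ k` vertices are isolated and no twin class is larger, then joining a new vertex to the
isolated ones keeps the sizes of the twin classes and leaves no isolated vertex. -/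
theorem hasPrimeExtension_succ_of_isIsolated [Finite V] {k : ℕ} (hk : 1 ≤ k)
    (hle : ∀ v, (twinClass G v).ncard ≤ 2 ^ k) {c : V} (hiso : G.IsIsolated c)
    (hc : (twinClass G c).ncard = 2 ^ k) : HasPrimeExtension G (k + 1) := by
  have htwo : 1 < 2 ^ k := Nat.one_lt_two_pow (by omega)
  have hcc : c ∈ twinClass G c := Twin.refl G c
  have hC := twinClass_eq_of_isIsolated hiso
  obtain ⟨d, hd, hdc⟩ := (Set.one_lt_ncard_iff_nontrivial.1 (hc ▸ htwo)).exists_ne c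
  rw [hC] at hd
  have hnt := not_twin_joinIsolated hd hiso hdc
  have hsub : ∀ v, twinClass (joinIsolated G) (.inl v) ⊆ Sum.inl '' twinClass G v := by
    rintro v (u | ⟨⟩) h
    · exact ⟨u, twin_of_twin_joinIsolated h, rfl⟩
    · exact absurd (Twin.symm h) (hnt v)
  have hnew : twinClass (joinIsolated G) (.inr ()) = {.inr ()} := by
    ext (v | ⟨⟩)
    · exact iff_of_false (hnt v) (by simp)
    · exact iff_of_true (Twin.refl _ _) rfl
  have hcl : twinClass (joinIsolated G) (.inl c) = Sum.inl '' twinClass G c := by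
    refine Set.Subset.antisymm (hsub c) ?_
    rintro _ ⟨u, hu, rfl⟩
    rw [hC] at hu
    rintro (x | ⟨⟩) _ _
    · exact iff_of_false (fun h => hu x h.symm) fun h => hiso x h.symm
    · exact iff_of_true hu hiso
  have hcard : ∀ v, (Sum.inl '' twinClass G v : Set (V ⊕ Unit)).ncard = (twinClass G v).ncard :=
    fun v => Set.ncard_image_of_injective _ Sum.inl_injective
  refine HasPrimeExtension.of_sum_unit (K := joinIsolated G)
    (hasPrimeExtension_of_stable hk ?_ (.inl c) (by rw [hcl, hcard, hc]) ?_ ?_)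
  · rintro (v | ⟨⟩)
    · exact (Set.ncard_le_ncard (hsub v)).trans ((hcard v).trans_le (hle v))
    · rw [hnew, Set.ncard_singleton]
      exact htwo.le
  · rw [hcl]
    rintro _ ⟨u, hu, rfl⟩ _ ⟨v, hv, rfl⟩ huv
    rw [hC] at hu
    exact (SimpleGraph.compl_adj _ _ _).2 ⟨huv, hu v⟩
  · rintro (v | ⟨⟩) hv
    · refine ⟨fun h => h (.inr ()) fun x hx => h (.inl x) hx, fun h => ?_⟩
      -- a universal vertex would be adjacent to the isolated vertices `c` and `d`
      have key : ∀ x, G.IsIsolated x → x = v := fun x hx => by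
        by_contra hxv
        exact h (.inl x) ((SimpleGraph.compl_adj _ _ _).2
          ⟨fun e => hxv (Sum.inl_injective e).symm, fun h' => hx v h'.symm⟩)
      exact hdc ((key d hd).trans (key c hiso).symm)
    · rw [hnew, Set.ncard_singleton] at hv
      omega

/-! ### Modular clique and stability numbers -/

theorem modularCliqueNumber_spec [Finite V] (G : SimpleGraph V) :
    (∀ M : Set V, IsModule G M → G.IsClique M → M.ncard ≤ modularCliqueNumber G) ∧
      ∃ M : Set V, IsModule G M ∧ G.IsClique M ∧ M.ncard = modularCliqueNumber G := by
  have hbdd : BddAbove {m : ℕ | ∃ M : Finset V,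
      IsModule G (M : Set V) ∧ G.IsClique (M : Set V) ∧ M.card = m} := by
    refine ⟨Nat.card V, ?_⟩
    rintro _ ⟨M, -, -, rfl⟩
    rw [← Set.ncard_coe_finset, ← Set.ncard_univ]
    exact Set.ncard_le_ncard (Set.subset_univ _)
  constructor
  · intro M hM hc
    obtain ⟨N, rfl⟩ := M.toFinite.exists_finset_coe
    rw [Set.ncard_coe_finset]
    exact le_csSup hbdd ⟨N, hM, hc, rfl⟩
  · obtain ⟨M, hM, hc, h⟩ := Nat.sSup_mem
      (s := {m : ℕ | ∃ M : Finset V,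
        IsModule G (M : Set V) ∧ G.IsClique (M : Set V) ∧ M.card = m})
      ⟨0, ∅, fun v _ => by simp, by simp, rfl⟩ hbdd
    exact ⟨M, hM, hc, by rw [Set.ncard_coe_finset]; exact h⟩

theorem ncard_twinClass_le [Finite V] (v : V) : (twinClass G v).ncard ≤
    max (modularStabilityNumber G) (modularCliqueNumber G) := by
  rcases isClique_twinClass_or (G := G) v with h | h
  · exact le_max_of_le_right ((modularCliqueNumber_spec G).1 _ (isModule_twinClass v) h)
  · exact le_max_of_le_left ((modularCliqueNumber_spec Gᶜ).1 _
      (isModule_compl_iff.2 (isModule_twinClass v)) h)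

/-- A largest modular clique is a twin class. -/
theorem exists_twinClass_ncard_eq [Finite V] {n : ℕ} (hn : 0 < n) (h : modularCliqueNumber G = n)
    (hle : ∀ v, (twinClass G v).ncard ≤ n) :
    ∃ c, (twinClass G c).ncard = n ∧ G.IsClique (twinClass G c) := by
  obtain ⟨M, hM, hcl, hcard⟩ := (modularCliqueNumber_spec G).2
  obtain ⟨c, hc⟩ := Set.nonempty_of_ncard_ne_zero (by omega : M.ncard ≠ 0)
  have hsub : M ⊆ twinClass G c := fun u hu => twin_of_isClique hM hcl hu hc
  have heq : M = twinClass G c :=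
    Set.eq_of_subset_of_ncard_le hsub ((hle c).trans (by rw [hcard, h]))
  exact ⟨c, heq ▸ hcard.trans h, heq ▸ hcl⟩

theorem isolatedCount_eq_iff {n : ℕ} (hn : 0 < n) :
    isolatedCount G = n ↔ ∃ v, G.IsIsolated v ∧ (twinClass G v).ncard = n := by
  constructor
  · intro h
    have hne : {v : V | G.IsIsolated v}.ncard ≠ 0 := h.trans_ne hn.ne'
    obtain ⟨v, hv⟩ := Set.nonempty_of_ncard_ne_zero hne
    exact ⟨v, hv, by rw [twinClass_eq_of_isIsolated hv]; exact h⟩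
  · rintro ⟨v, hv, h⟩
    rwa [twinClass_eq_of_isIsolated hv] at h

/-! ### The prime bound -/

theorem primeBound_eq {p : ℕ} (h : HasPrimeExtension G p)
    (hmin : ∀ q, HasPrimeExtension G q → p ≤ q) : primeBound G = p :=
  le_antisymm (Nat.sInf_le h) (le_csInf ⟨p, h⟩ hmin)

theorem primeBound_compl (G : SimpleGraph V) : primeBound Gᶜ = primeBound G :=
  congrArg sInf (Set.ext fun _ => ⟨fun h => by simpa using HasPrimeExtension.compl h,
    HasPrimeExtension.compl⟩)

theorem primeBound_of_isolatedCount_eq [Finite V] {k : ℕ} (hk : 1 ≤ k)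
    (hle : ∀ v, (twinClass G v).ncard ≤ 2 ^ k) (h : isolatedCount G = 2 ^ k) :
    primeBound G = k + 1 := by
  obtain ⟨c, hc, hcard⟩ := (isolatedCount_eq_iff (by positivity)).1 h
  refine primeBound_eq (hasPrimeExtension_succ_of_isIsolated hk hle hc hcard) fun q hq => ?_
  refine lt_of_le_of_ne (le_of_hasPrimeExtension hq hcard) ?_
  rintro rfl
  exact not_hasPrimeExtension_of_isIsolated hc hcard hq

theorem primeBound_of_stable [Finite V] {k : ℕ} (hk : 1 ≤ k)
    (hle : ∀ v, (twinClass G v).ncard ≤ 2 ^ k) (hst : modularStabilityNumber G = 2 ^ k)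
    (h₁ : isolatedCount G ≠ 2 ^ k) (h₂ : isolatedCount Gᶜ ≠ 2 ^ k) : primeBound G = k := by
  have hpos : 0 < 2 ^ k := by positivity
  obtain ⟨c, hc, hcl⟩ := exists_twinClass_ncard_eq hpos hst fun v => by
    rw [twinClass_compl]; exact hle v
  rw [twinClass_compl] at hc hcl
  refine primeBound_eq (hasPrimeExtension_of_stable hk hle c hc hcl fun v hv => ⟨fun h => ?_,
    fun h => ?_⟩) fun q hq => le_of_hasPrimeExtension hq hc
  · exact h₁ ((isolatedCount_eq_iff hpos).2 ⟨v, h, hv⟩)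
  · exact h₂ ((isolatedCount_eq_iff hpos).2 ⟨v, h, by rwa [twinClass_compl]⟩)

end PrimeBound

theorem theorem5 {V : Type*} [Finite V] (G : SimpleGraph V) (k : ℕ) (hk : 1 ≤ k)
    (hG : max (PrimeBound.modularStabilityNumber G) (PrimeBound.modularCliqueNumber G) = 2 ^ k) :
    (PrimeBound.primeBound G = k ∨ PrimeBound.primeBound G = k + 1) ∧
      (PrimeBound.primeBound G = k + 1 ↔
        PrimeBound.isolatedCount G = 2 ^ k ∨ PrimeBound.isolatedCount Gᶜ = 2 ^ k) := by
  have hle : ∀ v, (PrimeBound.twinClass G v).ncard ≤ 2 ^ k := fun v =>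
    hG ▸ PrimeBound.ncard_twinClass_le v
  have hle' : ∀ v, (PrimeBound.twinClass Gᶜ v).ncard ≤ 2 ^ k := fun v => by
    rw [PrimeBound.twinClass_compl]; exact hle v
  by_cases h : PrimeBound.isolatedCount G = 2 ^ k ∨ PrimeBound.isolatedCount Gᶜ = 2 ^ k
  · have hp : PrimeBound.primeBound G = k + 1 := by
      rcases h with h | h
      · exact PrimeBound.primeBound_of_isolatedCount_eq hk hle h
      · rw [← PrimeBound.primeBound_compl]
        exact PrimeBound.primeBound_of_isolatedCount_eq hk hle' h
    exact ⟨.inr hp, iff_of_true hp h⟩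
  · have hp : PrimeBound.primeBound G = k := by
      push Not at h
      rcases max_choice (PrimeBound.modularStabilityNumber G) (PrimeBound.modularCliqueNumber G)
        with hm | hm <;> rw [hm] at hG
      · exact PrimeBound.primeBound_of_stable hk hle hG h.1 h.2
      · rw [← PrimeBound.primeBound_compl]
        refine PrimeBound.primeBound_of_stable hk hle' ?_ h.2 (by rw [compl_compl]; exact h.1)
        rwa [PrimeBound.modularStabilityNumber, compl_compl]
    exact ⟨.inl hp, iff_of_false (by omega) h⟩
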